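/- Let $S$ be a $\mathrm{Cu}$-semigroup, that is, a commutative monoid with a partial order such that $0\le x$ for all $x$ and $x\le y$ implies $x+z\le y+z$, and such that, with $x\ll y$ meaning that for every increasing sequence $(y_n)_n$ with $y\le\sup_n y_n$ there is $n$ with $x\le y_n$, the following hold: (O1) every increasing sequence has a supremum; (O2) every element is the supremum of a $\ll$-increasing sequence; (O3) $x'\ll x$ and $y'\ll y$ imply $x'+y'\ll x+y$; (O4) $\sup_n(x_n+y_n)=\sup_n x_n+\sup_n y_n$ for all increasing sequences $(x_n)_n,(y_n)_n$. Assume moreover that $S$ satisfies: (O5) if $r+s\le t$, $r'\ll r$ and $s'\ll s$, then there is $u\in S$ with $r'+u\le t\le r+u$ and $s'\ll u$; (O6) if $x'\ll x\le y+z$, then there are $e,f\in S$ with $x'\le e+f$, $e\le x$, $e\le y$, $f\le x$ and $f\le z$; (O7) if $x_1'\ll x_1\le w$ and $x_2'\ll x_2\le w$, then there is $x\in S$ with $x_1'\ll x$, $x_2'\ll x$, $x\le w$ and $x\le x_1+x_2$. Let $I$ be an ideal of $S$, that is, a submonoid that is closed under suprema of increasing sequences and downward hereditary ($x\le y\in I$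 implies $x\in I$). Write $x\le_I y$ if $x\le y+w$ for some $w\in I$, and let $S/I$ be the set of classes for the equivalence relation "$x\le_I y$ and $y\le_I x$", with the addition induced from $S$ and the partial order induced by $\le_I$; equip $I$ with the addition and order of $S$. For $m\in\mathbb{N}=\{0,1,2,\ldots\}$, say that a partially ordered commutative monoid $T$ has $m$-comparison if $x\le y_0+\cdots+y_m$ for all $x,y_0,\ldots,y_m\in T$ such that for each $j$ there is $n\in\mathbb{N}$ with $(n+1)x\le n y_j$. Let $m_1,m_2\in\mathbb{N}$. If $S/I$ has $m_1$-comparison and $I$ has $m_2$-comparison, then $S$ has $(m_1+m_2+1)$-comparison. -/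

import Mathlib

/-- The (sequential) way-below relation `x ≪ y`: whenever an increasing sequence `u` has a supremum
`s` with `y ≤ s`, already `x ≤ u n` for some `n`. -/
def CuWayBelow {S : Type*} [PartialOrder S] (x y : S) : Prop :=
  ∀ (u : ℕ → S) (s : S), Monotone u → IsLUB (Set.range u) s → y ≤ s → ∃ n, x ≤ u n

/-- A `Cu`-semigroup: a positively ordered (commutative) monoid satisfying the axioms (O1)-(O4). -/
class IsCuSemigroup (S : Type*) [AddCommMonoid S] [PartialOrder S] : Prop
    extends IsOrderedAddMonoid S where
  /-- the order is positive -/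
  zero_le' : ∀ x : S, 0 ≤ x
  /-- (O1) increasing sequences have suprema -/
  exists_isLUB : ∀ u : ℕ → S, Monotone u → ∃ s, IsLUB (Set.range u) s
  /-- (O2) every element is the supremum of a `≪`-increasing sequence -/
  exists_wayBelow_seq : ∀ x : S, ∃ u : ℕ → S,
    (∀ n, CuWayBelow (u n) (u (n + 1))) ∧ IsLUB (Set.range u) x
  /-- (O3) addition is compatible with `≪` -/
  add_wayBelow_add : ∀ x' x y' y : S, CuWayBelow x' x → CuWayBelow y' y →
    CuWayBelow (x' + y') (x + y)
  /-- (O4) addition is compatible with suprema of increasing sequences -/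
  isLUB_add : ∀ (u v : ℕ → S) (s t : S), Monotone u → Monotone v →
    IsLUB (Set.range u) s → IsLUB (Set.range v) t →
    IsLUB (Set.range fun n => u n + v n) (s + t)

/-- (O5), almost algebraic order. -/
def CuAxiomO5 (S : Type*) [AddCommMonoid S] [PartialOrder S] : Prop :=
  ∀ r' r s' s t : S, r + s ≤ t → CuWayBelow r' r → CuWayBelow s' s →
    ∃ u : S, r' + u ≤ t ∧ t ≤ r + u ∧ CuWayBelow s' u

/-- (O6), almost Riesz decomposition. -/
def CuAxiomO6 (S : Type*) [AddCommMonoid S] [PartialOrder S] : Prop :=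
  ∀ x' x y z : S, CuWayBelow x' x → x ≤ y + z →
    ∃ e f : S, x' ≤ e + f ∧ e ≤ x ∧ e ≤ y ∧ f ≤ x ∧ f ≤ z

/-- (O7). -/
def CuAxiomO7 (S : Type*) [AddCommMonoid S] [PartialOrder S] : Prop :=
  ∀ x₁' x₁ x₂' x₂ w : S, CuWayBelow x₁' x₁ → x₁ ≤ w → CuWayBelow x₂' x₂ → x₂ ≤ w →
    ∃ x : S, CuWayBelow x₁' x ∧ CuWayBelow x₂' x ∧ x ≤ w ∧ x ≤ x₁ + x₂

/-- The relation `x <ₛ y`: there is `n : ℕ` with `(n + 1) x ≤ n y`. -/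
def CuStablyBelow {S : Type*} [AddCommMonoid S] [PartialOrder S] (x y : S) : Prop :=
  ∃ n : ℕ, (n + 1) • x ≤ n • y

/-- `m`-comparison: `x <ₛ y₀, …, yₘ` implies `x ≤ y₀ + … + yₘ`. -/
def HasCuComparison (m : ℕ) (S : Type*) [AddCommMonoid S] [PartialOrder S] : Prop :=
  ∀ (x : S) (y : Fin (m + 1) → S), (∀ j, CuStablyBelow x (y j)) → x ≤ ∑ j, y j

/-- An ideal of `S`: a submonoid closed under suprema of increasing sequences and downward
hereditary. As a semigroup in its own right it is the type `I.toAddSubmonoid`, with the addition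
and order inherited from `S`. -/
structure CuIdeal (S : Type*) [AddCommMonoid S] [PartialOrder S] extends AddSubmonoid S where
  isLUB_mem' : ∀ (u : ℕ → S) (s : S), Monotone u → (∀ n, u n ∈ carrier) →
    IsLUB (Set.range u) s → s ∈ carrier
  mem_of_le' : ∀ x y : S, x ≤ y → y ∈ carrier → x ∈ carrier

namespace CuIdeal

/-- The relation `x ≤_I y`: there is `w ∈ I` with `x ≤ y + w`. -/
def LE {S : Type*} [AddCommMonoid S] [PartialOrder S] (I : CuIdeal S) (x y : S) : Prop :=
  ∃ w ∈ I.toAddSubmonoid, x ≤ y + w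

theorem LE.refl {S : Type*} [AddCommMonoid S] [PartialOrder S] (I : CuIdeal S) (x : S) :
    I.LE x x :=
  ⟨0, I.toAddSubmonoid.zero_mem, by simp⟩

theorem LE.trans {S : Type*} [AddCommMonoid S] [PartialOrder S] [IsOrderedAddMonoid S]
    {I : CuIdeal S} {x y z : S} (h₁ : I.LE x y) (h₂ : I.LE y z) : I.LE x z := by
  obtain ⟨w, hw, h⟩ := h₁
  obtain ⟨v, hv, k⟩ := h₂
  refine ⟨v + w, I.toAddSubmonoid.add_mem hv hw, h.trans ?_⟩
  rw [← add_assoc]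
  gcongr

theorem LE.add {S : Type*} [AddCommMonoid S] [PartialOrder S] [IsOrderedAddMonoid S]
    {I : CuIdeal S} {x y x₂ y₂ : S} (h₁ : I.LE x y) (h₂ : I.LE x₂ y₂) :
    I.LE (x + x₂) (y + y₂) := by
  obtain ⟨w, hw, h⟩ := h₁
  obtain ⟨v, hv, k⟩ := h₂
  refine ⟨w + v, I.toAddSubmonoid.add_mem hw hv, ?_⟩
  rw [add_add_add_comm]
  gcongr

/-- The congruence `x ∼_I y`, meaning `x ≤_I y` and `y ≤_I x`. -/
def con {S : Type*} [AddCommMonoid S] [PartialOrder S] [IsOrderedAddMonoid S] (I : CuIdeal S) :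
    AddCon S where
  r x y := I.LE x y ∧ I.LE y x
  iseqv := ⟨fun x => ⟨LE.refl I x, LE.refl I x⟩, fun h => ⟨h.2, h.1⟩,
    fun h k => ⟨h.1.trans k.1, k.2.trans h.2⟩⟩
  add' h k := ⟨h.1.add k.1, h.2.add k.2⟩

/-- The quotient `S/I` of equivalence classes for `∼_I`. -/
def Quotient {S : Type*} [AddCommMonoid S] [PartialOrder S] [IsOrderedAddMonoid S]
    (I : CuIdeal S) : Type _ :=
  I.con.Quotient

/-- The addition on `S/I` is the one induced by the addition on `S`. -/
instance instAddCommMonoid {S : Type*} [AddCommMonoid S] [PartialOrder S] [IsOrderedAddMonoid S]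
    (I : CuIdeal S) :
    AddCommMonoid I.Quotient :=
  inferInstanceAs (AddCommMonoid I.con.Quotient)

/-- The quotient map `S → S/I`. -/
def proj {S : Type*} [AddCommMonoid S] [PartialOrder S] [IsOrderedAddMonoid S] (I : CuIdeal S) :
    S →+ I.Quotient :=
  I.con.mk'

/-- The partial order on `S/I` is the one induced by `≤_I`. -/
instance instPartialOrder {S : Type*} [AddCommMonoid S] [PartialOrder S] [IsOrderedAddMonoid S]
    (I : CuIdeal S) :
    PartialOrder I.Quotient where
  le a b := Quotient.liftOn₂ (s₁ := I.con.toSetoid) (s₂ := I.con.toSetoid) a b I.LE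
    fun _ _ _ _ h k => propext
      ⟨fun l => (h.2.trans l).trans k.1, fun l => (h.1.trans l).trans k.2⟩
  le_refl a := Quotient.inductionOn (s := I.con.toSetoid) a fun x => LE.refl I x
  le_trans a b c := Quotient.inductionOn₃ (s₁ := I.con.toSetoid) (s₂ := I.con.toSetoid)
    (s₃ := I.con.toSetoid) a b c fun _ _ _ h k => LE.trans h k
  le_antisymm a b := Quotient.inductionOn₂ (s₁ := I.con.toSetoid) (s₂ := I.con.toSetoid) a b
    fun _ _ h k => Quotient.sound (s := I.con.toSetoid) ⟨h, k⟩

theorem proj_le_proj_iff {S : Type*} [AddCommMonoid S] [PartialOrder S] [IsOrderedAddMonoid S]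
    (I : CuIdeal S) (x y : S) : I.proj x ≤ I.proj y ↔ I.LE x y :=
  Iff.rfl

end CuIdeal

/-! Let `x` be stably below all `y j`, and let `x' ≪ x`; by (O2) it suffices to bound `x'`.
Comparison in `S/I`, applied to the first `m₁ + 1` of the `y j`, bounds `x` by their sum plus some
`w ∈ I`. By (O6) the part of `x` below `w` can be split off, so `x' ≤ ∑ y j + f'` where `f' ≪ f`
for some `f ∈ I` with `f ≤ x`. In particular `f` is stably below each of the remaining `m₂ + 1`
elements `y j`.

To use comparison in `I`, these `y j` have to be replaced by elements of `I`. This is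
`CuIdeal.exists_mem_le_nsmul`: if `a ∈ I` and `a' ≪ a ≤ n • y`, then already `a' ≤ n • z` for some
`z ∈ I` with `z ≤ y`. Indeed, (O6) bounds `a'` by a sum of `n` elements lying below both `a` and
`y`, and (O7) provides a single element of `I` below `y` that dominates (approximations of) all of
them. Applying this with `a = (n + 1) • f` and `a' = (n + 1) • f'` shows that `f'` is stably below
elements `z j ∈ I` with `z j ≤ y j`, so `f' ≤ ∑ z j ≤ ∑ y j` over the remaining indices.
-/

namespace CuWayBelow

section Order

variable {S : Type*} [PartialOrder S] {x y z : S}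

theorem le (h : CuWayBelow x y) : x ≤ y := by
  obtain ⟨_, hn⟩ := h (fun _ => y) y monotone_const (by simp) le_rfl
  exact hn

theorem trans_le (h : CuWayBelow x y) (k : y ≤ z) : CuWayBelow x z :=
  fun u s hu hs hz => h u s hu hs (k.trans hz)

end Order

theorem _root_.LE.le.trans_cuWayBelow {S : Type*} [PartialOrder S] {x y z : S} (h : x ≤ y)
    (k : CuWayBelow y z) : CuWayBelow x z :=
  fun u s hu hs hz => (k u s hu hs hz).imp fun _ => h.trans

variable {S : Type*} [AddCommMonoid S] [PartialOrder S] [IsCuSemigroup S] {x y z : S}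

theorem nsmul (h : CuWayBelow x y) (n : ℕ) : CuWayBelow (n • x) (n • y) := by
  induction n with
  | zero =>
    rw [zero_nsmul, zero_nsmul]
    exact fun u _ _ _ _ => ⟨0, IsCuSemigroup.zero_le' _⟩
  | succ n ih =>
    rw [succ_nsmul, succ_nsmul]
    exact IsCuSemigroup.add_wayBelow_add _ _ _ _ ih h

theorem exists_between (h : CuWayBelow x y) : ∃ z, CuWayBelow x z ∧ CuWayBelow z y := by
  obtain ⟨u, hu, hs⟩ := IsCuSemigroup.exists_wayBelow_seq y
  obtain ⟨n, hn⟩ := h u y (monotone_nat_of_le_succ fun n => (hu n).le) hs le_rfl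
  exact ⟨u (n + 1), hn.trans_cuWayBelow (hu n), (hu (n + 1)).trans_le (hs.1 ⟨n + 2, rfl⟩)⟩

theorem exists_le_add (h : CuWayBelow x (y + z)) :
    ∃ y' z', CuWayBelow y' y ∧ CuWayBelow z' z ∧ x ≤ y' + z' := by
  obtain ⟨u, hu, hus⟩ := IsCuSemigroup.exists_wayBelow_seq y
  obtain ⟨v, hv, hvs⟩ := IsCuSemigroup.exists_wayBelow_seq z
  have hum : Monotone u := monotone_nat_of_le_succ fun n => (hu n).le
  have hvm : Monotone v := monotone_nat_of_le_succ fun n => (hv n).le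
  obtain ⟨n, hn⟩ := h _ _ (hum.add hvm) (IsCuSemigroup.isLUB_add u v y z hum hvm hus hvs) le_rfl
  exact ⟨u n, v n, (hu n).trans_le (hus.1 ⟨n + 1, rfl⟩), (hv n).trans_le (hvs.1 ⟨n + 1, rfl⟩), hn⟩

end CuWayBelow

namespace IsCuSemigroup

variable {S : Type*} [AddCommMonoid S] [PartialOrder S] [IsCuSemigroup S]

theorem le_of_forall_wayBelow {x y : S} (h : ∀ x', CuWayBelow x' x → x' ≤ y) : x ≤ y := by
  obtain ⟨u, hu, hs⟩ := exists_wayBelow_seq x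
  refine hs.2 ?_
  rintro _ ⟨n, rfl⟩
  exact h _ ((hu n).trans_le (hs.1 ⟨n + 1, rfl⟩))

theorem isLUB_nsmul {u : ℕ → S} {s : S} (hu : Monotone u) (hs : IsLUB (Set.range u) s) (n : ℕ) :
    IsLUB (Set.range fun k => n • u k) (n • s) := by
  induction n with
  | zero => simp
  | succ n ih =>
    simp only [succ_nsmul]
    exact isLUB_add _ _ _ _ (fun _ _ hij => nsmul_le_nsmul_right (hu hij) n) hu ih hs

end IsCuSemigroup

theorem CuWayBelow.exists_le_nsmul {S : Type*} [AddCommMonoid S] [PartialOrder S]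
    [IsCuSemigroup S] {x y : S} {n : ℕ} (h : CuWayBelow x (n • y)) :
    ∃ y', CuWayBelow y' y ∧ x ≤ n • y' := by
  obtain ⟨u, hu, hs⟩ := IsCuSemigroup.exists_wayBelow_seq y
  have hum : Monotone u := monotone_nat_of_le_succ fun n => (hu n).le
  obtain ⟨k, hk⟩ := h _ _ (fun _ _ hij => nsmul_le_nsmul_right (hum hij) n)
    (IsCuSemigroup.isLUB_nsmul hum hs n) le_rfl
  exact ⟨u k, (hu k).trans_le (hs.1 ⟨k + 1, rfl⟩), hk⟩

/-- If `a` in the ideal `I` is bounded by a multiple of `y`, then, up to passing to `a' ≪ a`, it is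
bounded by the same multiple of an element of `I` below `y`. -/
theorem CuIdeal.exists_mem_le_nsmul {S : Type*} [AddCommMonoid S] [PartialOrder S]
    [IsCuSemigroup S] (hO6 : CuAxiomO6 S) (hO7 : CuAxiomO7 S) (I : CuIdeal S) {y : S} (n : ℕ)
    {a' a : S} (ha : a ∈ I.toAddSubmonoid) (haa : CuWayBelow a' a) (hay : a ≤ n • y) :
    ∃ z ∈ I.toAddSubmonoid, z ≤ y ∧ a' ≤ n • z := by
  induction n generalizing a a' with
  | zero =>
    refine ⟨0, I.toAddSubmonoid.zero_mem, IsCuSemigroup.zero_le' y, ?_⟩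
    simpa using haa.le.trans hay
  | succ n ih =>
    obtain ⟨a'', h₁, h₂⟩ := haa.exists_between
    rw [succ_nsmul] at hay
    obtain ⟨e, f, hef, hea, hey, hfa, hfy⟩ := hO6 a'' a _ _ h₂ hay
    have heI : e ∈ I.toAddSubmonoid := I.mem_of_le' _ _ hea ha
    have hfI : f ∈ I.toAddSubmonoid := I.mem_of_le' _ _ hfa ha
    obtain ⟨e', f', he', hf', hef'⟩ := (h₁.trans_le hef).exists_le_add
    obtain ⟨e'', he₁, he₂⟩ := he'.exists_between
    obtain ⟨z, hzI, hzy, hez⟩ := ih heI he₂ hey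
    obtain ⟨z', hz', hez'⟩ := (he₁.trans_le hez).exists_le_nsmul
    obtain ⟨v, hzv, hfv, hvy, hvle⟩ := hO7 z' z f' f y hz' hzy hf' hfy
    refine ⟨v, I.mem_of_le' _ _ hvle (I.toAddSubmonoid.add_mem hzI hfI), hvy, ?_⟩
    rw [succ_nsmul]
    exact hef'.trans (add_le_add (hez'.trans (nsmul_le_nsmul_right hzv.le n)) hfv.le)

theorem CuStablyBelow.map {S T : Type*} [AddCommMonoid S] [PartialOrder S] [AddCommMonoid T]
    [PartialOrder T] {x y : S} (f : S →+ T) (hf : Monotone f) (h : CuStablyBelow x y) :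
    CuStablyBelow (f x) (f y) := by
  obtain ⟨n, hn⟩ := h
  exact ⟨n, by simpa only [map_nsmul] using hf hn⟩

theorem CuIdeal.proj_monotone {S : Type*} [AddCommMonoid S] [PartialOrder S]
    [IsOrderedAddMonoid S] (I : CuIdeal S) : Monotone I.proj :=
  fun x y h => (I.proj_le_proj_iff x y).2 ⟨0, I.toAddSubmonoid.zero_mem, by simpa using h⟩

/-- Comparison in the ideal `I` also bounds elements of `I` by elements of `S` outside of `I`, up
to passing to `f' ≪ f`. -/
theorem CuIdeal.le_sum_of_mem {S : Type*} [AddCommMonoid S] [PartialOrder S]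
    [IsCuSemigroup S] (hO6 : CuAxiomO6 S) (hO7 : CuAxiomO7 S) (I : CuIdeal S) {m : ℕ}
    (hI : HasCuComparison m I.toAddSubmonoid) {f' f : S} (hf : f ∈ I.toAddSubmonoid)
    (hff : CuWayBelow f' f) {y : Fin (m + 1) → S} (hy : ∀ j, CuStablyBelow f (y j)) :
    f' ≤ ∑ j, y j := by
  have key (j) : ∃ z : I.toAddSubmonoid, (z : S) ≤ y j ∧ ∃ n : ℕ, (n + 1) • f' ≤ n • (z : S) := by
    obtain ⟨n, hn⟩ := hy j
    obtain ⟨z, hz, hzy, hle⟩ := I.exists_mem_le_nsmul hO6 hO7 n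
      (I.toAddSubmonoid.nsmul_mem hf (n + 1)) (hff.nsmul (n + 1)) hn
    exact ⟨⟨z, hz⟩, hzy, n, hle⟩
  choose z hzy hz using key
  have h := hI ⟨f', I.mem_of_le' _ _ hff.le hf⟩ z fun j => (hz j).imp fun n hn => by
    rw [← Subtype.coe_le_coe]
    simpa using hn
  rw [← Subtype.coe_le_coe, AddSubmonoid.coe_finsetSum] at h
  exact h.trans (Finset.sum_le_sum fun j _ => hzy j)

theorem proposition4p6 {S : Type*} [AddCommMonoid S] [PartialOrder S] [IsCuSemigroup S]
    (hO5 : CuAxiomO5 S) (hO6 : CuAxiomO6 S) (hO7 : CuAxiomO7 S) (I : CuIdeal S) (m₁ m₂ : ℕ)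
    (hquot : HasCuComparison m₁ I.Quotient) (hideal : HasCuComparison m₂ I.toAddSubmonoid) :
    HasCuComparison (m₁ + m₂ + 1) S := by
  intro x y hy
  have hm : (m₁ + 1) + (m₂ + 1) = m₁ + m₂ + 1 + 1 := by omega
  let y₁ : Fin (m₁ + 1) → S := fun j => y (finCongr hm (Fin.castAdd _ j))
  let y₂ : Fin (m₂ + 1) → S := fun j => y (finCongr hm (Fin.natAdd _ j))
  have hsum : ∑ j, y j = ∑ j, y₁ j + ∑ j, y₂ j := by
    rw [← Equiv.sum_comp (finCongr hm), Fin.sum_univ_add]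
  obtain ⟨w, hwI, hw⟩ : I.LE x (∑ j, y₁ j) := by
    rw [← I.proj_le_proj_iff, map_sum]
    exact hquot _ _ fun j => (hy _).map I.proj I.proj_monotone
  rw [hsum]
  refine IsCuSemigroup.le_of_forall_wayBelow fun x' hx' => ?_
  obtain ⟨x'', h₁, h₂⟩ := hx'.exists_between
  obtain ⟨e, f, hef, -, hey, hfx, hfw⟩ := hO6 x'' x _ _ h₂ hw
  obtain ⟨e', f', he', hf', hle⟩ := (h₁.trans_le hef).exists_le_add
  refine hle.trans (add_le_add (he'.le.trans hey) ?_)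
  exact I.le_sum_of_mem hO6 hO7 hideal (I.mem_of_le' _ _ hfw hwI) hf'
    fun j => (hy _).imp fun n hn => (nsmul_le_nsmul_right hfx (n + 1)).trans hn
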